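/- All graphs are finite and simple. For a graph $G$, let $n(G)$ be its number of vertices, and let $n_o(G)$ and $n_e(G)$ be the numbers of vertices of odd and of even degree, respectively. A path decomposition of $G$ is a collection of pairwise edge-disjoint paths in $G$ that covers all the edges of $G$, and $p(G)$ is the minimum number of paths in a path decomposition of $G$. Let $P_m$ denote the path on $m$ vertices and let $\Box$ denote the Cartesian product of graphs. **Theorem 3.1.** For every integer $m \ge 2$ and every connected graph $H$, $$p(P_m\Box H)\;\le\;\frac{m\,n_o(H)}{2}+n_e(H)\qquad\text{and}\qquad p(P_m\Box H)\;\le\;\frac{n(P_m\Box H)}{2}.$$ -/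

import Mathlib

namespace GallaiPath

open SimpleGraph

/-- A subgraph of `G` is a path if it consists of the vertices and edges traversed by a walk
without repeated vertices. -/
def IsPathSubgraph {V : Type*} {G : SimpleGraph V} (P : G.Subgraph) : Prop :=
  ∃ (u v : V) (w : G.Walk u v), w.IsPath ∧ w.toSubgraph = P

/-- A path decomposition of `G`: a finite collection of pairwise edge-disjoint paths in `G`
that covers all the edges of `G`. -/
structure IsPathDecomposition {V : Type*} (G : SimpleGraph V) (D : Finset G.Subgraph) : Prop where
  isPath : ∀ P ∈ D, IsPathSubgraph P
  edgeDisjoint : ∀ P ∈ D, ∀ Q ∈ D, P ≠ Q → Disjoint P.edgeSet Q.edgeSet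
  cover : ∀ e ∈ G.edgeSet, ∃ P ∈ D, e ∈ P.edgeSet

/-- `p(G)`: the minimum number of paths in a path decomposition of `G`. For finite `G` the
minimum exists, see `exists_isPathDecomposition_card_eq`. -/
noncomputable def pathNumber {V : Type*} (G : SimpleGraph V) : ℕ :=
  sInf {k : ℕ | ∃ D : Finset G.Subgraph, IsPathDecomposition G D ∧ D.card = k}

/-- `n_o(G)`: the number of vertices of odd degree. -/
def numOdd {V : Type*} [Fintype V] (G : SimpleGraph V) [DecidableRel G.Adj] : ℕ :=
  (Finset.univ.filter fun v => Odd (G.degree v)).card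

/-- `n_e(G)`: the number of vertices of even degree. -/
def numEven {V : Type*} [Fintype V] (G : SimpleGraph V) [DecidableRel G.Adj] : ℕ :=
  (Finset.univ.filter fun v => Even (G.degree v)).card

/-- Every finite graph has a path decomposition: take every edge as a path. -/
theorem exists_isPathDecomposition {V : Type*} [Finite V] (G : SimpleGraph V) :
    ∃ D : Finset G.Subgraph, IsPathDecomposition G D := by
  classical
  have hfin : {P : G.Subgraph | ∃ (a b : V) (h : G.Adj a b), P = G.subgraphOfAdj h}.Finite :=
    Set.toFinite _
  refine ⟨hfin.toFinset, ?_, ?_, ?_⟩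
  · intro P hP
    obtain ⟨a, b, h, rfl⟩ := hfin.mem_toFinset.1 hP
    refine ⟨a, b, h.toWalk, ?_, ?_⟩
    · simp [Walk.cons_isPath_iff, h.ne]
    · simp
  · intro P hP Q hQ hne
    obtain ⟨a, b, h, rfl⟩ := hfin.mem_toFinset.1 hP
    obtain ⟨c, d, h', rfl⟩ := hfin.mem_toFinset.1 hQ
    rw [edgeSet_subgraphOfAdj, edgeSet_subgraphOfAdj, Set.disjoint_singleton]
    intro he
    apply hne
    rcases Sym2.eq_iff.1 he with ⟨rfl, rfl⟩ | ⟨rfl, rfl⟩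
    · rfl
    · exact (subgraphOfAdj_symm h).symm
  · intro e he
    induction e with
    | _ a b =>
      have h : G.Adj a b := he
      refine ⟨G.subgraphOfAdj h, hfin.mem_toFinset.2 ⟨a, b, h, rfl⟩, ?_⟩
      rw [edgeSet_subgraphOfAdj]
      exact Set.mem_singleton _

/-- For a finite graph the minimum in the definition of `pathNumber` is attained. -/
theorem exists_isPathDecomposition_card_eq {V : Type*} [Finite V] (G : SimpleGraph V) :
    ∃ D : Finset G.Subgraph, IsPathDecomposition G D ∧ D.card = pathNumber G := by
  obtain ⟨D, hD⟩ := exists_isPathDecomposition G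
  exact Nat.sInf_mem (s := {k : ℕ | ∃ D : Finset G.Subgraph, IsPathDecomposition G D ∧ D.card = k})
    ⟨_, D, hD, rfl⟩

/-- Any path decomposition bounds `pathNumber` from above. -/
theorem pathNumber_le_card {V : Type*} {G : SimpleGraph V} {D : Finset G.Subgraph}
    (hD : IsPathDecomposition G D) : pathNumber G ≤ D.card :=
  Nat.sInf_le ⟨D, hD, rfl⟩

end GallaiPath

namespace GallaiPath

open SimpleGraph

/-! The proof strengthens Lovász's path decomposition and lifts it layer by layer. If trivial
one-vertex paths are allowed, the edges of $H$ split into paths so that each odd vertex is an end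
exactly once and each even vertex exactly twice (`exists_pathSystem_count_endsOf`). The induction on
edges also carries a variant in which a chosen even vertex is no end at all. Its engine is
`exists_pathSystem_cons_edge`: a new edge $ba$ is absorbed by rerouting paths through $a$, at the
price of moving one end from $b$ to $a$.

Joining the two ends of each path gives an auxiliary multigraph of maximum degree two. Orienting it
with in- and outdegrees at most one (`exists_orientation_nodup`) orients the paths so that starts
are distinct and termini are distinct. Let $A$ be the set of starts and $B$ the set of termini. Then
$|A|=|B|$, $A\cup B$ is everything, $A\cap B$ is the set of even vertices, and $|B\setminus
A|=n_o/2$.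

The same oriented paths are used in every layer of $P_m\Box H$. The vertical edge at $u$ prolongs
the path that terminates at $u$, if there is one, and leads into the path that starts at $u$ one
layer higher, if there is one (`exists_staircases`). Each of the $m-1$ passages closes $|B\setminus
A|$ paths, and $|B|$ remain at the top, so the total is $(m-1)n_o/2+n_o/2+n_e$. -/

variable {α β : Type*}

/-! ### Paths as lists, and path systems -/

/-- The multiset of edges joining consecutive entries of a list. -/
def listEdges : List α → Multiset (Sym2 α)
  | [] => 0
  | [_] => 0
  | x :: y :: t => s(x, y) ::ₘ listEdges (y :: t)

/-- The two ends of a nonempty list, with multiplicity. -/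
def listEnds (l : List α) : Multiset α :=
  (l.head?.toList : Multiset α) + (l.getLast?.toList : Multiset α)

@[simp] theorem listEdges_nil : listEdges ([] : List α) = 0 := rfl

@[simp] theorem listEdges_singleton (x : α) : listEdges [x] = 0 := rfl

@[simp] theorem listEdges_cons_cons (x y : α) (t : List α) :
    listEdges (x :: y :: t) = s(x, y) ::ₘ listEdges (y :: t) := rfl

theorem listEdges_append (l₁ l₂ : List α) (x y : α) :
    listEdges (l₁ ++ x :: y :: l₂) =
      s(x, y) ::ₘ (listEdges (l₁ ++ [x]) + listEdges (y :: l₂)) := by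
  induction l₁ with
  | nil => simp
  | cons z l ih =>
    cases l with
    | nil => simp [Multiset.cons_swap]
    | cons w l =>
      simp only [List.cons_append, listEdges_cons_cons] at ih ⊢
      rw [ih, Multiset.cons_swap, Multiset.cons_add]

theorem listEdges_reverse (l : List α) : listEdges l.reverse = listEdges l := by
  induction l with
  | nil => rfl
  | cons x l ih =>
    cases l with
    | nil => rfl
    | cons y l =>
      have h := listEdges_append l.reverse [] y x
      simp only [List.reverse_cons, List.append_assoc, List.singleton_append, listEdges_cons_cons]
        at h ih ⊢
      rw [h, ih, Sym2.eq_swap, listEdges_singleton, add_zero]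

theorem listEdges_map (f : α → β) (l : List α) :
    listEdges (l.map f) = (listEdges l).map (Sym2.map f) := by
  induction l with
  | nil => rfl
  | cons x l ih =>
    cases l with
    | nil => rfl
    | cons y l =>
      simp only [List.map_cons, listEdges_cons_cons, Multiset.map_cons, Sym2.map_mk] at ih ⊢
      rw [ih]

theorem listEnds_reverse (l : List α) : listEnds l.reverse = listEnds l := by
  simp [listEnds, add_comm]

@[simp] theorem listEnds_singleton (x : α) : listEnds [x] = {x, x} := rfl

/-- `D` is a family of lists without repetitions whose consecutive pairs make up exactly
the multiset `E`. -/
structure PathSystem (D : Multiset (List α)) (E : Multiset (Sym2 α)) : Prop where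
  ne_nil : ∀ l ∈ D, l ≠ []
  nodup : ∀ l ∈ D, l.Nodup
  sum_edges : (D.map listEdges).sum = E

/-- The ends of all lists in a family, with multiplicity. -/
def endsOf (D : Multiset (List α)) : Multiset α := (D.map listEnds).sum

@[simp] theorem endsOf_cons (l : List α) (D : Multiset (List α)) :
    endsOf (l ::ₘ D) = listEnds l + endsOf D := by simp [endsOf]

theorem pathSystem_cons {l : List α} {D : Multiset (List α)} {E : Multiset (Sym2 α)} :
    PathSystem (l ::ₘ D) E ↔
      l ≠ [] ∧ l.Nodup ∧ ∃ E', PathSystem D E' ∧ listEdges l + E' = E := by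
  constructor
  · rintro ⟨h₁, h₂, h₃⟩
    refine ⟨h₁ l (by simp), h₂ l (by simp), _, ⟨fun k hk => h₁ k (by simp [hk]),
      fun k hk => h₂ k (by simp [hk]), rfl⟩, by simpa using h₃⟩
  · rintro ⟨h₁, h₂, E', ⟨h₃, h₄, h₅⟩, rfl⟩
    refine ⟨?_, ?_, by simp [h₅]⟩
    · simpa [h₁] using h₃
    · simpa [h₂] using h₄

/-! ### Absorbing an edge by moving an end -/

/-- An end of a family may be taken to be the head of one of its lists. -/
theorem exists_head_of_mem_endsOf {D : Multiset (List α)} {v : α} (hv : v ∈ endsOf D) :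
    ∃ t, v :: t ∈ D ∨ (v :: t).reverse ∈ D := by
  rw [endsOf] at hv
  obtain ⟨l, hl, hvl⟩ : ∃ l ∈ D, v ∈ listEnds l := by
    induction D using Multiset.induction with
    | empty => simp at hv
    | cons l D ih =>
      simp only [Multiset.map_cons, Multiset.sum_cons, Multiset.mem_add] at hv
      rcases hv with h | h
      · exact ⟨l, by simp, h⟩
      · obtain ⟨k, hk, hvk⟩ := ih h
        exact ⟨k, by simp [hk], hvk⟩
  simp only [listEnds, Multiset.mem_add, Multiset.mem_coe, Option.mem_toList] at hvl
  rcases hvl with h | h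
  · refine ⟨l.tail, Or.inl ?_⟩
    rwa [List.cons_head?_tail h]
  · rw [← List.head?_reverse] at h
    refine ⟨l.reverse.tail, Or.inr ?_⟩
    rwa [List.cons_head?_tail h, List.reverse_reverse]

/-- Paths matter only up to reversal, so a path can be stored in whichever direction is convenient.
The last clause keeps track of where the other paths went. -/
theorem exists_cons_of_mem_or_reverse_mem {D : Multiset (List α)} {E : Multiset (Sym2 α)}
    (hD : PathSystem D E) {l : List α} (hl : l ∈ D ∨ l.reverse ∈ D) :
    ∃ D₀, PathSystem (l ::ₘ D₀) E ∧ endsOf (l ::ₘ D₀) = endsOf D ∧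
      ∀ k, (k ∈ D ∨ k.reverse ∈ D) → k = l ∨ k = l.reverse ∨ k ∈ D₀ ∨ k.reverse ∈ D₀ := by
  rcases hl with h | h
  · obtain ⟨D₀, rfl⟩ := Multiset.exists_cons_of_mem h
    refine ⟨D₀, hD, rfl, fun k hk => ?_⟩
    simp only [Multiset.mem_cons, List.reverse_eq_iff] at hk
    tauto
  · obtain ⟨D₀, rfl⟩ := Multiset.exists_cons_of_mem h
    refine ⟨D₀, ?_, by simp [listEnds_reverse], fun k hk => ?_⟩
    · rw [pathSystem_cons] at hD ⊢
      simpa [listEdges_reverse] using hD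
    · simp only [Multiset.mem_cons, List.reverse_inj] at hk
      tauto

/-- If the path from $b$ avoids $a$, prepend $a$. Otherwise it has the form $b\dots p\,a\dots$;
replacing $pa$ by $ba$ turns it into $p\dots b\,a\dots$, and the task becomes to absorb $pa$ at $p$.
The set $S$ holds the vertices that may still play the role of $b$: each begins a path which, if it
meets $a$, enters it from $S$. A vertex that has been used leaves $S$, so the process stops. -/
theorem exists_pathSystem_cons_edge_of_closed (a : α) (n : ℕ) :
    ∀ (S : Finset α) (b : α) (D : Multiset (List α)) (E : Multiset (Sym2 α)), S.card = n →
      PathSystem D E → E.Nodup → b ∈ S → a ∉ S → s(b, a) ∉ E →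
      (∀ c ∈ S, ∃ t, (c :: t ∈ D ∨ (c :: t).reverse ∈ D) ∧
        ∀ x p y, c :: t = x ++ p :: a :: y → p ∈ S) →
      ∃ D', PathSystem D' (s(b, a) ::ₘ E) ∧ b ::ₘ endsOf D' = a ::ₘ endsOf D := by
  classical
  induction n with
  | zero =>
    intro S b D E hS _ _ hb
    simp [Finset.card_eq_zero.1 hS] at hb
  | succ n ih =>
    intro S b D E hS hD hE hb ha hab hcl
    obtain ⟨t, ht, htS⟩ := hcl b hb
    have hba : b ≠ a := fun h => ha (h ▸ hb)
    obtain ⟨D₀, hD₀, hends, hmem⟩ := exists_cons_of_mem_or_reverse_mem hD ht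
    obtain ⟨-, hnd, E₀, hDE₀, hE₀⟩ := pathSystem_cons.1 hD₀
    by_cases hat : a ∈ b :: t
    · -- switch the initial segment of the path from `b`
      obtain ⟨u, y, huy⟩ := List.append_of_mem hat
      obtain ⟨x, p, rfl⟩ : ∃ x p, u = x ++ [p] := by
        rcases List.eq_nil_or_concat u with rfl | ⟨x, p, h⟩
        · simp at huy; exact absurd huy.1 hba
        · exact ⟨x, p, by simpa using h⟩
      rw [List.append_assoc, List.singleton_append] at huy
      have hpS : p ∈ S := htS x p y huy
      obtain ⟨z, hz⟩ : ∃ z, x ++ [p] = b :: z := by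
        cases x with
        | nil => simp at huy; exact ⟨[], by simp [huy.1]⟩
        | cons x₀ x => simp at huy; exact ⟨x ++ [p], by simp [huy.1]⟩
      have hbt : b :: t = b :: z ++ a :: y := by rw [huy, ← hz]; simp
      have hedges : listEdges (b :: t) = s(p, a) ::ₘ (listEdges (b :: z) + listEdges (a :: y)) := by
        rw [huy, listEdges_append, hz]
      have hpb : p ≠ b := by
        rintro rfl
        apply hab
        rw [← hE₀, hedges]; simp
      set l' := (b :: z).reverse ++ a :: y with hl'
      have hedges' : listEdges l' = s(b, a) ::ₘ (listEdges (b :: z) + listEdges (a :: y)) := by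
        rw [hl', List.reverse_cons, List.append_assoc, List.singleton_append, listEdges_append,
          ← List.reverse_cons, listEdges_reverse]
      have hE' : s(p, a) ::ₘ (listEdges l' + E₀) = s(b, a) ::ₘ E := by
        rw [← hE₀, hedges, hedges']
        simp only [Multiset.cons_add]
        rw [Multiset.cons_swap]
      have hnd' : l'.Nodup := by
        rw [hbt] at hnd
        exact ((List.reverse_perm (b :: z)).append_right (a :: y)).nodup_iff.2 hnd
      have hD' : PathSystem (l' ::ₘ D₀) (listEdges l' + E₀) :=
        pathSystem_cons.2 ⟨by simp [hl'], hnd', E₀, hDE₀, rfl⟩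
      have hndE : (s(p, a) ::ₘ (listEdges l' + E₀)).Nodup := by
        rw [hE']; exact Multiset.nodup_cons.2 ⟨hab, hE⟩
      have hzrev : (b :: z).reverse = p :: x.reverse := by rw [← hz]; simp
      have hends' : b ::ₘ listEnds l' = p ::ₘ listEnds (b :: t) := by
        have h1 : (b :: t).getLast? = (a :: y).getLast? := by
          rw [hbt, List.getLast?_append_cons]
        have h2 : l'.getLast? = (a :: y).getLast? := by
          rw [hl', List.getLast?_append_cons]
        have h3 : l'.head? = some p := by rw [hl', hzrev]; simp
        simp only [listEnds, h1, h2, h3, List.head?_cons, Option.toList_some,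
          Multiset.coe_singleton, Multiset.singleton_add]
        rw [Multiset.cons_swap]
      -- The end lost by $b$ has gone to $p$, and $pa$ is the edge left uncovered. For `S.erase b`
      -- to be closed, each remaining vertex needs a path that does not enter $a$ from $b$; the
      -- paths it had before the switch provide this.
      obtain ⟨D', hD'E, hD'ends⟩ := ih (S.erase b) p (l' ::ₘ D₀) _
        (by rw [Finset.card_erase_of_mem hb, hS]; rfl) hD' (Multiset.nodup_cons.1 hndE).2
        (Finset.mem_erase.2 ⟨hpb, hpS⟩) (fun h => ha (Finset.mem_of_mem_erase h))
        (Multiset.nodup_cons.1 hndE).1 (by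
          intro c hc
          obtain ⟨hcb, hcS⟩ := Finset.mem_erase.1 hc
          obtain ⟨r, hr, hrS⟩ := hcl c hcS
          -- No old path enters $a$ from $b$, because $ba$ was not yet covered.
          have hfresh : ∀ x p y, c :: r = x ++ p :: a :: y → p ∈ S.erase b := by
            intro x p y hxy
            refine Finset.mem_erase.2 ⟨?_, hrS x p y hxy⟩
            rintro rfl
            apply hab
            have : s(p, a) ∈ listEdges (c :: r) := by rw [hxy, listEdges_append]; simp
            rw [← hD.sum_edges]
            rcases hr with hr | hr
            · exact Multiset.mem_of_le (Multiset.le_sum_of_mem (Multiset.mem_map_of_mem _ hr)) this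
            · rw [← listEdges_reverse] at this
              exact Multiset.mem_of_le (Multiset.le_sum_of_mem (Multiset.mem_map_of_mem _ hr)) this
          rcases hmem _ hr with h | h | h | h
          · exact absurd (List.cons.inj h).1 hcb
          · -- `c` is the other end of the switched path
            have hcr : c :: r = y.reverse ++ a :: (b :: z).reverse := by
              rw [h, hbt]; simp
            cases hy : y.reverse with
            | nil =>
              rw [hy] at hcr
              exact absurd ((List.cons.inj hcr).1 ▸ hcS) ha
            | cons c' y' =>
              rw [hy] at hcr
              obtain ⟨rfl, hr'⟩ := List.cons.inj hcr
              refine ⟨y' ++ a :: b :: z, Or.inr ?_, ?_⟩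
              · rw [Multiset.mem_cons]; left
                rw [hl', ← List.reverse_inj]
                simp [hy]
              · intro x₁ p₁ y₁ h₁
                have hnd1 : (c :: (y' ++ a :: b :: z)).Nodup := by
                  have := List.nodup_reverse.2 hnd'
                  rw [hl'] at this
                  simpa [hy] using this
                -- the entries before `a` agree
                have hsplit : c :: y' = x₁ ++ [p₁] := by
                  have e : (c :: y') ++ a :: (b :: z) = (x₁ ++ [p₁]) ++ a :: y₁ := by
                    simpa using h₁
                  have hn1 : a ∉ c :: y' := by
                    intro hm
                    have : ((c :: y') ++ a :: (b :: z)).Nodup := by simpa using hnd1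
                    exact (List.nodup_append.1 this).2.2 a hm a (by simp) rfl
                  have hn2 : a ∉ x₁ ++ [p₁] := by
                    intro hm
                    have : ((x₁ ++ [p₁]) ++ a :: y₁).Nodup := by
                      rw [← e]; simpa using hnd1
                    exact (List.nodup_append.1 this).2.2 a hm a (by simp) rfl
                  -- Both lists contain $a$ once, so truncating the equation at $a$ compares the
                  -- initial segments.
                  have := congrArg (List.takeWhile (fun w => decide (w ≠ a))) e
                  rwa [List.takeWhile_append_of_pos, List.takeWhile_append_of_pos,
                    List.takeWhile_cons_of_neg, List.takeWhile_cons_of_neg, List.append_nil,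
                    List.append_nil] at this
                  · simp
                  · simp
                  · intro w hw; simp; rintro rfl; exact hn2 hw
                  · intro w hw; simp; rintro rfl; exact hn1 hw
                exact hfresh x₁ p₁ (b :: z).reverse (by rw [hcr, hsplit]; simp)
          · exact ⟨r, Or.inl (by simp [h]), hfresh⟩
          · exact ⟨r, Or.inr (by rw [Multiset.mem_cons]; exact Or.inr h), hfresh⟩)
      refine ⟨D', by rwa [hE'] at hD'E, ?_⟩
      rw [endsOf_cons] at hD'ends
      have : p ::ₘ (b ::ₘ endsOf D') = p ::ₘ (a ::ₘ endsOf D) := by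
        rw [Multiset.cons_swap, hD'ends, Multiset.cons_swap, ← Multiset.cons_add, hends',
          ← hends, endsOf_cons, Multiset.cons_add, Multiset.cons_swap]
      exact (Multiset.cons_inj_right p).1 this
    · refine ⟨(a :: b :: t) ::ₘ D₀, ?_, ?_⟩
      · refine pathSystem_cons.2 ⟨by simp, List.nodup_cons.2 ⟨hat, hnd⟩, E₀, hDE₀, ?_⟩
        rw [listEdges_cons_cons, Multiset.cons_add, hE₀, Sym2.eq_swap]
      · rw [← hends]
        simp only [endsOf_cons, listEnds, List.head?_cons, List.getLast?_cons_cons,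
          Option.toList_some, Multiset.coe_singleton, Multiset.singleton_add, Multiset.cons_add]
        rw [Multiset.cons_swap]

/-- If every neighbour of `a` is an end, then the edge `s(b, a)` can be added to a path
system, turning an end at `b` into an end at `a`. -/
theorem exists_pathSystem_cons_edge [Finite α] {a b : α} {D : Multiset (List α)}
    {E : Multiset (Sym2 α)} (hD : PathSystem D E) (hE : (s(b, a) ::ₘ E).Nodup) (hba : b ≠ a)
    (hends : ∀ c, c ≠ a → s(c, a) ∈ s(b, a) ::ₘ E → c ∈ endsOf D) :
    ∃ D', PathSystem D' (s(b, a) ::ₘ E) ∧ b ::ₘ endsOf D' = a ::ₘ endsOf D := by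
  classical
  have := Fintype.ofFinite α
  rw [Multiset.nodup_cons] at hE
  refine exists_pathSystem_cons_edge_of_closed a _
    (Finset.univ.filter fun c => c ≠ a ∧ s(c, a) ∈ s(b, a) ::ₘ E) b D E rfl hD hE.2
    (by simp [hba]) (by simp) hE.1 ?_
  intro c hc
  simp only [Finset.mem_filter, Finset.mem_univ, true_and] at hc
  obtain ⟨t, ht⟩ := exists_head_of_mem_endsOf (hends c hc.1 hc.2)
  refine ⟨t, ht, fun x p y hxy => ?_⟩
  have hnd : (c :: t).Nodup := by
    rcases ht with ht | ht
    · exact hD.nodup _ ht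
    · exact List.nodup_reverse.1 (hD.nodup _ ht)
  have hmem : s(p, a) ∈ E := by
    have : s(p, a) ∈ listEdges (c :: t) := by rw [hxy, listEdges_append]; simp
    rw [← hD.sum_edges]
    rcases ht with ht | ht
    · exact Multiset.mem_of_le (Multiset.le_sum_of_mem (Multiset.mem_map_of_mem _ ht)) this
    · rw [← listEdges_reverse] at this
      exact Multiset.mem_of_le (Multiset.le_sum_of_mem (Multiset.mem_map_of_mem _ ht)) this
  simp only [Finset.mem_filter, Finset.mem_univ, true_and]
  refine ⟨?_, by simp [hmem]⟩
  rintro rfl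
  rw [hxy, List.nodup_append] at hnd
  simp at hnd

/-! ### Lovász's theorem with prescribed ends -/

theorem pathSystem_singleton_cons {D : Multiset (List α)} {E : Multiset (Sym2 α)} {a : α} :
    PathSystem ([a] ::ₘ D) E ↔ PathSystem D E := by
  rw [pathSystem_cons]; simp

/-- A vertex which lies on no edge can be an end only of a trivial path. -/
theorem singleton_mem_of_mem_endsOf {D : Multiset (List α)} {E : Multiset (Sym2 α)}
    (hD : PathSystem D E) {a : α} (ha : a ∈ endsOf D) (hE : ∀ e ∈ E, a ∉ e) : [a] ∈ D := by
  obtain ⟨t, ht⟩ := exists_head_of_mem_endsOf ha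
  cases t with
  | nil => simpa using ht
  | cons b t =>
    exfalso
    have hm : s(a, b) ∈ listEdges (a :: b :: t) := by simp
    refine hE s(a, b) ?_ (by simp)
    rw [← hD.sum_edges]
    rcases ht with ht | ht
    · exact Multiset.mem_of_le (Multiset.le_sum_of_mem (Multiset.mem_map_of_mem _ ht)) hm
    · rw [← listEdges_reverse] at hm
      exact Multiset.mem_of_le (Multiset.le_sum_of_mem (Multiset.mem_map_of_mem _ ht)) hm

/-- The number of path ends required at `v`: two if `v` has even degree with respect to the
edge set `E`, one otherwise. -/
def endDemand [DecidableEq α] (E : Finset (Sym2 α)) (v : α) : ℕ :=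
  if Even (E.filter (v ∈ ·)).card then 2 else 1

section

variable [DecidableEq α]

theorem endDemand_pos (E : Finset (Sym2 α)) (v : α) : 0 < endDemand E v := by
  unfold endDemand; split_ifs <;> simp

/-- The parity at $v$ flips, so the two demands are 1 and 2 in some order. -/
theorem endDemand_insert_of_mem {E : Finset (Sym2 α)} {e : Sym2 α} (he : e ∉ E) {v : α}
    (hv : v ∈ e) : endDemand (insert e E) v + endDemand E v = 3 := by
  have : (insert e E).filter (v ∈ ·) = insert e (E.filter (v ∈ ·)) := by
    rw [Finset.filter_insert, if_pos hv]
  unfold endDemand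
  rw [this, Finset.card_insert_of_notMem (by simp [he])]
  by_cases h : Even (E.filter (v ∈ ·)).card
  · simp [h, Nat.even_add_one]
  · rw [if_neg h, if_pos (Nat.even_add_one.2 h)]

theorem endDemand_insert_of_notMem (E : Finset (Sym2 α)) {e : Sym2 α} {v : α}
    (hv : v ∉ e) : endDemand (insert e E) v = endDemand E v := by
  have : (insert e E).filter (v ∈ ·) = E.filter (v ∈ ·) := by
    rw [Finset.filter_insert, if_neg hv]
  unfold endDemand
  rw [this]

/-- The exemption of $a$ from the end condition is essential: it lets the edge be added to a system
in which $a$ is no end at all. -/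
theorem exists_pathSystem_insert [Finite α] {a b : α} {D : Multiset (List α)}
    {E : Finset (Sym2 α)} (hD : PathSystem D E.val) (he : s(b, a) ∉ E) (hba : b ≠ a)
    (hends : ∀ c, c ≠ a → 0 < (endsOf D).count c) :
    ∃ D', PathSystem D' (insert s(b, a) E).val ∧
      (endsOf D').count b + 1 = (endsOf D).count b ∧
      (endsOf D').count a = (endsOf D).count a + 1 ∧
      ∀ v, v ≠ a → v ≠ b → (endsOf D').count v = (endsOf D).count v := by
  have hval : (insert s(b, a) E).val = s(b, a) ::ₘ E.val := Finset.insert_val_of_notMem he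
  obtain ⟨D', hD', h⟩ := exists_pathSystem_cons_edge hD (hval ▸ (insert s(b, a) E).nodup) hba
    (fun c hc _ => Multiset.count_pos.1 (hends c hc))
  refine ⟨D', hval ▸ hD', ?_, ?_, fun v hva hvb => ?_⟩
  · have := congrArg (Multiset.count b) h
    rwa [Multiset.count_cons_self, Multiset.count_cons_of_ne hba] at this
  · have := congrArg (Multiset.count a) h
    rwa [Multiset.count_cons_self, Multiset.count_cons_of_ne hba.symm] at this
  · have := congrArg (Multiset.count v) h
    rwa [Multiset.count_cons_of_ne hva, Multiset.count_cons_of_ne hvb] at this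

/-- Lovász's theorem on path decompositions, together with the variant in which a prescribed
vertex of even degree is not an end. -/
theorem exists_pathSystem_count_endsOf_aux [Finite α] (n : ℕ) :
    ∀ E : Finset (Sym2 α), E.card = n → (∀ e ∈ E, ¬ e.IsDiag) →
      (∃ D, PathSystem D E.val ∧ ∀ v, (endsOf D).count v = endDemand E v) ∧
      ∀ a, endDemand E a = 2 →
        ∃ D, PathSystem D E.val ∧ (endsOf D).count a = 0 ∧
          ∀ v, v ≠ a → (endsOf D).count v = endDemand E v := by
  have := Fintype.ofFinite α
  induction n with
  | zero =>
    intro E hE _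
    obtain rfl := Finset.card_eq_zero.1 hE
    have hps : ∀ s : Finset α, PathSystem (s.val.map fun v => [v]) (∅ : Finset (Sym2 α)).val := by
      intro s
      refine ⟨by simp, by simp, ?_⟩
      rw [Multiset.map_map]
      simp
    have hcount : ∀ (s : Finset α) (v : α),
        (endsOf (s.val.map fun v => [v])).count v = if v ∈ s then 2 else 0 := by
      intro s v
      induction s using Finset.induction with
      | empty => simp [endsOf]
      | insert w s hw ih =>
        rw [Finset.insert_val_of_notMem hw, Multiset.map_cons, endsOf_cons, Multiset.count_add, ih]
        by_cases hvw : v = w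
        · subst hvw; simp [hw]
        · simp [hvw]
    have hdem : ∀ v : α, endDemand ∅ v = 2 := by simp [endDemand]
    refine ⟨⟨_, hps Finset.univ, fun v => by rw [hcount, hdem]; simp⟩, fun a _ =>
      ⟨_, hps (Finset.univ.erase a), by rw [hcount]; simp, fun v hv => ?_⟩⟩
    rw [hcount, hdem]; simp [hv]
  | succ n ih =>
    intro E hcard hE
    have step : ∀ b a, s(b, a) ∈ E → b ≠ a ∧ ∃ E' : Finset (Sym2 α), s(b, a) ∉ E' ∧
        E = insert s(b, a) E' ∧ E'.card = n ∧ ∀ e ∈ E', ¬ e.IsDiag := by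
      intro b a h
      refine ⟨fun hba => hE _ h (by simp [hba]), E.erase s(b, a), by simp,
        (Finset.insert_erase h).symm, by rw [Finset.card_erase_of_mem h, hcard]; rfl,
        fun e he => hE e (Finset.mem_of_mem_erase he)⟩
    have hpos : ∀ a c, s(a, c) ∈ E → endDemand E a = 2 →
        ∃ D, PathSystem D E.val ∧ (endsOf D).count a = 0 ∧
          ∀ v, v ≠ a → (endsOf D).count v = endDemand E v := by
      intro a c hac ha
      obtain ⟨hne, E', he, rfl, hcard', hE'⟩ := step a c hac
      have ha' := endDemand_insert_of_mem he (v := a) (by simp)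
      have hc' := endDemand_insert_of_mem he (v := c) (by simp)
      have hrest : ∀ v, v ≠ c → v ≠ a → endDemand (insert s(a, c) E') v = endDemand E' v :=
        fun v hvc hva => endDemand_insert_of_notMem _ (by simp [hvc, hva])
      -- Adding $ac$ moves an end from $a$ to $c$, so $a$ drops from one end to none. At $c$ the
      -- required count is 1 if the demand before was 2, reached from the variant with no end at
      -- $c$; otherwise it is 2, reached from 1.
      by_cases hc : endDemand E' c = 2
      · obtain ⟨D, hD, hDc, hDv⟩ := (ih E' hcard' hE').2 c hc
        obtain ⟨D', hD', h1, h2, h3⟩ := exists_pathSystem_insert hD he hne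
          (fun v hv => by rw [hDv v hv]; exact endDemand_pos _ _)
        refine ⟨D', hD', ?_, fun v hv => ?_⟩
        · have := hDv a hne; omega
        · by_cases hvc : v = c
          · subst hvc; omega
          · rw [h3 v hvc hv, hDv v hvc, hrest v hvc hv]
      · obtain ⟨D, hD, hDv⟩ := (ih E' hcard' hE').1
        obtain ⟨D', hD', h1, h2, h3⟩ := exists_pathSystem_insert hD he hne
          (fun v hv => by rw [hDv v]; exact endDemand_pos _ _)
        have hc1 : endDemand E' c = 1 := by
          unfold endDemand at hc ⊢; split_ifs at hc ⊢ <;> simp_all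
        refine ⟨D', hD', ?_, fun v hv => ?_⟩
        · have := hDv a; omega
        · by_cases hvc : v = c
          · subst hvc; have := hDv v; omega
          · rw [h3 v hvc hv, hDv v, hrest v hvc hv]
    have hfill : ∀ a, endDemand E a = 2 → (∃ D, PathSystem D E.val ∧ (endsOf D).count a = 0 ∧
          ∀ v, v ≠ a → (endsOf D).count v = endDemand E v) →
        ∃ D, PathSystem D E.val ∧ ∀ v, (endsOf D).count v = endDemand E v := by
      rintro a ha ⟨D, hD, hDa, hDv⟩
      refine ⟨[a] ::ₘ D, pathSystem_singleton_cons.2 hD, fun v => ?_⟩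
      rw [endsOf_cons, Multiset.count_add]
      by_cases hva : v = a
      · subst hva; simp [hDa, ha]
      · simp [hva, hDv v hva]
    have hfull : ∃ D, PathSystem D E.val ∧ ∀ v, (endsOf D).count v = endDemand E v := by
      obtain ⟨e, he⟩ : E.Nonempty := Finset.card_pos.1 (by omega)
      induction e with
      | _ a c =>
        by_cases ha : endDemand E a = 2
        · exact hfill a ha (hpos a c he ha)
        by_cases hc : endDemand E c = 2
        · exact hfill c hc (hpos c a (by rwa [Sym2.eq_swap]) hc)
        obtain ⟨hne, E', he', rfl, hcard', hE'⟩ := step a c he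
        have ha' := endDemand_insert_of_mem he' (v := a) (by simp)
        have hc' := endDemand_insert_of_mem he' (v := c) (by simp)
        have h12 : ∀ v, endDemand (insert s(a, c) E') v ≠ 2 →
            endDemand (insert s(a, c) E') v = 1 := by
          intro v hv
          unfold endDemand at hv ⊢; split_ifs at hv ⊢ <;> simp_all
        have ha1 := h12 a ha
        have hc1 := h12 c hc
        -- Both $a$ and $c$ are odd now, hence were even without the edge. Starting with no end at
        -- $c$ and two at $a$, the move leaves one at each.
        obtain ⟨D, hD, hDc, hDv⟩ := (ih E' hcard' hE').2 c (by omega)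
        obtain ⟨D', hD', h1, h2, h3⟩ := exists_pathSystem_insert hD he' hne
          (fun v hv => by rw [hDv v hv]; exact endDemand_pos _ _)
        refine ⟨D', hD', fun v => ?_⟩
        have := hDv a hne
        by_cases hvc : v = c
        · subst hvc; omega
        by_cases hva : v = a
        · subst hva; omega
        rw [h3 v hvc hva, hDv v hvc, endDemand_insert_of_notMem _ (by simp [hvc, hva])]
    refine ⟨hfull, fun a ha => ?_⟩
    -- At an isolated vertex both ends come from the trivial path, which is discarded.
    by_cases hiso : ∀ e ∈ E, a ∉ e
    · obtain ⟨D, hD, hDv⟩ := hfull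
      have haD : [a] ∈ D := singleton_mem_of_mem_endsOf hD
        (Multiset.count_pos.1 (by rw [hDv]; exact endDemand_pos _ _)) hiso
      obtain ⟨D₀, rfl⟩ := Multiset.exists_cons_of_mem haD
      refine ⟨D₀, pathSystem_singleton_cons.1 hD, ?_, fun v hv => ?_⟩
      · have := hDv a
        simp [ha] at this
        exact Multiset.count_eq_zero.2 this
      · rw [← hDv v]; simp [hv]
    · push Not at hiso
      obtain ⟨e, he, hae⟩ := hiso
      obtain ⟨c, rfl⟩ := Sym2.mem_iff_exists.1 hae
      exact hpos a c he ha

/-- Every loopless edge set decomposes into paths such that every vertex of odd degree is an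
end of one path and every vertex of even degree is an end twice. -/
theorem exists_pathSystem_count_endsOf [Finite α] (E : Finset (Sym2 α))
    (hE : ∀ e ∈ E, ¬ e.IsDiag) :
    ∃ D, PathSystem D E.val ∧ ∀ v, (endsOf D).count v = endDemand E v :=
  (exists_pathSystem_count_endsOf_aux _ E rfl hE).1

end

/-! ### Orienting the paths -/

/-- A multigraph (a multiset of pairs) of maximum degree at most two can be oriented such that
all indegrees and outdegrees are at most one. -/
theorem exists_orientation_nodup [DecidableEq α] (n : ℕ) :
    ∀ s : Multiset (α × α), s.card = n →
      (∀ v, (s.map Prod.fst + s.map Prod.snd).count v ≤ 2) →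
      ∃ s', Multiset.Rel (fun p q => q = p ∨ q = p.swap) s s' ∧
        (s'.map Prod.fst).Nodup ∧ (s'.map Prod.snd).Nodup := by
  induction n with
  | zero =>
    intro s hs _
    rw [Multiset.card_eq_zero] at hs
    subst hs
    exact ⟨0, Multiset.Rel.zero, by simp, by simp⟩
  | succ n ih =>
    have flip : ∀ (p : α × α) (t : Multiset (α × α)),
        (∃ s', Multiset.Rel (fun p q => q = p ∨ q = p.swap) (p.swap ::ₘ t) s' ∧
          (s'.map Prod.fst).Nodup ∧ (s'.map Prod.snd).Nodup) →
        ∃ s', Multiset.Rel (fun p q => q = p ∨ q = p.swap) (p ::ₘ t) s' ∧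
          (s'.map Prod.fst).Nodup ∧ (s'.map Prod.snd).Nodup := by
      rintro p t ⟨s', h, h'⟩
      obtain ⟨q, u, hq, hu, rfl⟩ := Multiset.rel_cons_left.1 h
      exact ⟨_, Multiset.Rel.cons (by rw [Prod.swap_swap] at hq; exact hq.symm) hu, h'⟩
    have merge : ∀ (x v y : α) (t : Multiset (α × α)), t.card + 2 = n + 1 →
        (∀ w, ((((x, v) ::ₘ (v, y) ::ₘ t).map Prod.fst +
          ((x, v) ::ₘ (v, y) ::ₘ t).map Prod.snd).count w ≤ 2)) →
        ∃ s', Multiset.Rel (fun p q => q = p ∨ q = p.swap) ((x, v) ::ₘ (v, y) ::ₘ t) s' ∧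
          (s'.map Prod.fst).Nodup ∧ (s'.map Prod.snd).Nodup := by
      intro x v y t ht hcount
      -- Suppress $v$: orient the single edge $xy$ and subdivide it again. The degree bound keeps
      -- $v$ off all other edges and away from $x$ and $y$, so $v$ gets one edge in and one out.
      obtain ⟨s', hs', hf, hl⟩ := ih ((x, y) ::ₘ t) (by simp; omega) (fun w => by
        have := hcount w
        simp only [Multiset.map_cons, Multiset.count_add, Multiset.count_cons] at this ⊢
        omega)
      obtain ⟨q, u, hq, hu, rfl⟩ := Multiset.rel_cons_left.1 hs'
      have hv0 : ∀ p ∈ t, p.1 ≠ v ∧ p.2 ≠ v := by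
        intro p hp
        have := hcount v
        simp only [Multiset.map_cons, Multiset.count_add, Multiset.count_cons] at this
        have h1 : Multiset.count v (t.map Prod.fst) = 0 := by simp at this; omega
        have h2 : Multiset.count v (t.map Prod.snd) = 0 := by simp at this; omega
        rw [Multiset.count_eq_zero] at h1 h2
        exact ⟨fun h => h1 (h ▸ Multiset.mem_map_of_mem _ hp),
          fun h => h2 (h ▸ Multiset.mem_map_of_mem _ hp)⟩
      have hvx : x ≠ v := by
        rintro rfl
        have := hcount x
        simp only [Multiset.map_cons, Multiset.count_add, Multiset.count_cons] at this
        simp at this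
        omega
      have hvy : y ≠ v := by
        rintro rfl
        have := hcount y
        simp only [Multiset.map_cons, Multiset.count_add, Multiset.count_cons] at this
        simp at this
        omega
      have hvu : ∀ p ∈ u, p.1 ≠ v ∧ p.2 ≠ v := by
        intro p hp
        obtain ⟨r, hr, h⟩ := Multiset.exists_mem_of_rel_of_mem (Multiset.rel_flip.2 hu) hp
        rcases h with rfl | rfl
        · exact hv0 _ hr
        · exact (hv0 _ hr).symm
      have hvu1 : v ∉ u.map Prod.fst := by
        simp only [Multiset.mem_map, not_exists, not_and]
        exact fun p hp => (hvu p hp).1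
      have hvu2 : v ∉ u.map Prod.snd := by
        simp only [Multiset.mem_map, not_exists, not_and]
        exact fun p hp => (hvu p hp).2
      rcases hq with rfl | rfl
      · refine ⟨(x, v) ::ₘ (v, y) ::ₘ u, .cons (.inl rfl) (.cons (.inl rfl) hu), ?_, ?_⟩
        · simp only [Multiset.map_cons, Multiset.nodup_cons, Multiset.mem_cons] at hf ⊢
          exact ⟨by simp [hvx, hf.1], hvu1, hf.2⟩
        · simp only [Multiset.map_cons, Multiset.nodup_cons, Multiset.mem_cons] at hl ⊢
          exact ⟨by simp [hvy.symm, hvu2], hl.1, hl.2⟩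
      · refine ⟨(v, x) ::ₘ (y, v) ::ₘ u, .cons (.inr rfl) (.cons (.inr rfl) hu), ?_, ?_⟩
        · simp only [Prod.swap_prod_mk, Multiset.map_cons, Multiset.nodup_cons,
            Multiset.mem_cons] at hf ⊢
          exact ⟨by simp [hvy.symm, hvu1], hf.1, hf.2⟩
        · simp only [Prod.swap_prod_mk, Multiset.map_cons, Multiset.nodup_cons,
            Multiset.mem_cons] at hl ⊢
          exact ⟨by simp [hvx, hl.1], hvu2, hl.2⟩
    intro s hs hcount
    obtain ⟨p, t, rfl⟩ : ∃ p t, s = p ::ₘ t := by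
      obtain ⟨p, hp⟩ := Multiset.card_pos_iff_exists_mem.1 (by omega : 0 < s.card)
      exact ⟨p, _, (Multiset.cons_erase hp).symm⟩
    rw [Multiset.card_cons] at hs
    have hflip : ∀ (p : α × α) (t : Multiset (α × α)) (v : α),
        ((p.swap ::ₘ t).map Prod.fst + (p.swap ::ₘ t).map Prod.snd).count v =
          ((p ::ₘ t).map Prod.fst + (p ::ₘ t).map Prod.snd).count v := by
      intro p t v
      simp only [Multiset.map_cons, Multiset.count_add, Multiset.count_cons, Prod.fst_swap,
        Prod.snd_swap]
      omega
    obtain ⟨x, y⟩ := p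
    by_cases h : ∃ q ∈ t, q.1 = x ∨ q.2 = x ∨ q.1 = y ∨ q.2 = y
    · obtain ⟨⟨z, w⟩, hq, h⟩ := h
      obtain ⟨u, rfl⟩ := Multiset.exists_cons_of_mem hq
      have hu : u.card + 2 = n + 1 := by simp at hs; omega
      simp only at h
      rcases h with rfl | rfl | rfl | rfl
      · apply flip
        exact merge y z w u hu (fun v => by rw [← Prod.swap_prod_mk, hflip]; exact hcount v)
      · rw [Multiset.cons_swap]
        exact merge z w y u hu (fun v => by rw [Multiset.cons_swap]; exact hcount v)
      · exact merge x z w u hu hcount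
      · rw [Multiset.cons_swap]
        apply flip
        rw [Multiset.cons_swap]
        refine merge x w z u hu (fun v => ?_)
        rw [Multiset.cons_swap, ← Prod.swap_prod_mk, hflip, Multiset.cons_swap]
        exact hcount v
    · push Not at h
      obtain ⟨s', hs', hf, hl⟩ := ih t (by omega) (fun v => by
        have := hcount v
        simp only [Multiset.map_cons, Multiset.count_add, Multiset.count_cons] at this ⊢
        omega)
      have hs'' : ∀ p ∈ s', p.1 ≠ x ∧ p.2 ≠ y := by
        intro p hp
        obtain ⟨r, hr, h'⟩ := Multiset.exists_mem_of_rel_of_mem (Multiset.rel_flip.2 hs') hp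
        obtain ⟨h1, h2, h3, h4⟩ := h r hr
        rcases h' with rfl | rfl
        · exact ⟨h1, h4⟩
        · exact ⟨h2, h3⟩
      refine ⟨(x, y) ::ₘ s', .cons (.inl rfl) hs', ?_, ?_⟩
      · simp only [Multiset.map_cons, Multiset.nodup_cons, Multiset.mem_map, not_exists, not_and]
        exact ⟨fun p hp => (hs'' p hp).1, hf⟩
      · simp only [Multiset.map_cons, Multiset.nodup_cons, Multiset.mem_map, not_exists, not_and]
        exact ⟨fun p hp => (hs'' p hp).2, hl⟩

/-- The lists of a path system in which every vertex is an end at most twice can be reversed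
such that all heads are distinct and all last entries are distinct. -/
theorem exists_pathSystem_nodup_heads [DecidableEq α] {D : Multiset (List α)}
    {E : Multiset (Sym2 α)} (hD : PathSystem D E) (h2 : ∀ v, (endsOf D).count v ≤ 2) :
    ∃ D', PathSystem D' E ∧ endsOf D' = endsOf D ∧
      (D'.map List.head?).Nodup ∧ (D'.map List.getLast?).Nodup := by
  have hends : (D.map List.head?) + (D.map List.getLast?) = (endsOf D).map some := by
    have hne := hD.ne_nil
    clear h2 hD
    induction D using Multiset.induction with
    | empty => simp [endsOf]
    | cons l D ih =>
      have h1 := ih (fun k hk => hne k (by simp [hk]))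
      have h3 := hne l (by simp)
      rw [endsOf_cons, Multiset.map_add, ← h1, listEnds, List.head?_eq_some_head h3,
        List.getLast?_eq_some_getLast h3]
      simp only [Multiset.map_cons, List.head?_eq_some_head h3, List.getLast?_eq_some_getLast h3,
        Option.toList_some, Multiset.coe_singleton, Multiset.map_singleton,
        Multiset.singleton_add, Multiset.cons_add, Multiset.add_cons]
      rw [Multiset.cons_swap]
  -- Each path becomes an edge between its ends, a trivial path becoming a loop. Swapping a pair
  -- corresponds to reversing the path.
  obtain ⟨s, hs, hf, hl⟩ := exists_orientation_nodup _
    (D.map fun l => (l.head?, l.getLast?)) rfl (fun v => by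
      rw [Multiset.map_map, Multiset.map_map]
      simp only [Function.comp_def]
      rw [hends]
      cases v with
      | none => rw [Multiset.count_eq_zero.2 (by simp)]; simp
      | some v =>
        rw [Multiset.count_map_eq_count' _ _ (Option.some_injective _)]
        exact h2 v)
  rw [Multiset.rel_map_left] at hs
  suffices H : ∃ D', PathSystem D' E ∧ endsOf D' = endsOf D ∧
      D'.map (fun l => (l.head?, l.getLast?)) = s by
    obtain ⟨D', h, h', rfl⟩ := H
    rw [Multiset.map_map] at hf hl
    exact ⟨D', h, h', hf, hl⟩
  clear hf hl h2 hends
  induction D using Multiset.induction generalizing s E with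
  | empty =>
    rw [Multiset.rel_zero_left] at hs
    exact ⟨0, hD, rfl, by simp [hs]⟩
  | cons l D ih =>
    obtain ⟨q, u, hq, hu, rfl⟩ := Multiset.rel_cons_left.1 hs
    obtain ⟨hne, hnd, E', hE', rfl⟩ := pathSystem_cons.1 hD
    obtain ⟨D', h1, h2, h3⟩ := ih hE' u hu
    rcases hq with rfl | rfl
    · exact ⟨l ::ₘ D', pathSystem_cons.2 ⟨hne, hnd, _, h1, rfl⟩, by simp [h2], by simp [h3]⟩
    · exact ⟨l.reverse ::ₘ D', pathSystem_cons.2 ⟨by simpa using hne, by simpa using hnd, _, h1,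
        by rw [listEdges_reverse]⟩, by simp [h2, listEnds_reverse], by simp [h3]⟩

/-- A loopless edge set decomposes into oriented paths `q w`, leading from `s w` to `w`, such
that every vertex of odd degree is either the start or the terminus of one path and every vertex
of even degree is both the start of one and the terminus of one path. -/
theorem exists_oriented_paths [DecidableEq α] [Finite α] [Nonempty α] (E : Finset (Sym2 α))
    (hE : ∀ e ∈ E, ¬ e.IsDiag) :
    ∃ (B : Finset α) (q : α → List α) (s : α → α),
      (∀ w ∈ B, (q w).head? = some (s w) ∧ (q w).getLast? = some w ∧ (q w).Nodup) ∧
      Set.InjOn s B ∧ ∑ w ∈ B, listEdges (q w) = E.val ∧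
      ∀ v, (if v ∈ B.image s then 1 else 0) + (if v ∈ B then 1 else 0) = endDemand E v := by
  obtain ⟨D₀, hD₀, hcount₀⟩ := exists_pathSystem_count_endsOf E hE
  obtain ⟨D, hD, hends, hheads, hlasts⟩ := exists_pathSystem_nodup_heads hD₀ (fun v => by
    rw [hcount₀, endDemand]; split_ifs <;> simp)
  have hcount : ∀ v, (endsOf D).count v = endDemand E v := fun v => by rw [hends, hcount₀]
  let v₀ : α := Classical.arbitrary α
  -- Distinct last entries exclude repeated lists; below they also allow each path to be indexed by
  -- its terminus.
  lift D to Finset (List α) using Multiset.Nodup.of_map _ hlasts with F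
  let fin : List α → α := fun l => l.getLastD v₀
  let st : List α → α := fun l => l.headD v₀
  have hfin : ∀ l ∈ F, l.getLast? = some (fin l) := by
    intro l hl
    have := hD.ne_nil l hl
    rw [List.getLast?_eq_some_getLast this]
    simp [fin, List.getLastD_eq_getLast?, List.getLast?_eq_some_getLast this]
  have hst : ∀ l ∈ F, l.head? = some (st l) := by
    intro l hl
    have := hD.ne_nil l hl
    rw [List.head?_eq_some_head this]
    simp [st, List.headD_eq_head?_getD, List.head?_eq_some_head this]
  have hfinj : Set.InjOn fin F := by
    intro l hl k hk h
    exact Multiset.inj_on_of_nodup_map hlasts l hl k hk (by rw [hfin l hl, hfin k hk, h])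
  have hsinj : Set.InjOn st F := by
    intro l hl k hk h
    exact Multiset.inj_on_of_nodup_map hheads l hl k hk (by rw [hst l hl, hst k hk, h])
  let q : α → List α := Function.invFunOn fin F
  have hq : ∀ l ∈ F, q (fin l) = l := fun l hl => hfinj.leftInvOn_invFunOn hl
  have hB : ∀ w ∈ F.image fin, q w ∈ F ∧ fin (q w) = w := by
    intro w hw
    obtain ⟨l, hl, rfl⟩ := Finset.mem_image.1 hw
    rw [hq l hl]; exact ⟨hl, rfl⟩
  have hsinj' : Set.InjOn (fun w => st (q w)) (F.image fin : Finset α) := by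
    intro w hw w' hw' h
    have := hsinj (hB w hw).1 (hB w' hw').1 h
    rw [← (hB w hw).2, this, (hB w' hw').2]
  have hsum : ∀ {M : Type _} [AddCommMonoid M] (f : List α → M),
      ∑ w ∈ F.image fin, f (q w) = ∑ l ∈ F, f l := by
    intro M _ f
    rw [Finset.sum_image hfinj]
    exact Finset.sum_congr rfl fun l hl => by rw [hq l hl]
  refine ⟨F.image fin, q, fun w => st (q w), fun w hw => ?_, hsinj', ?_, fun v => ?_⟩
  · obtain ⟨h1, h2⟩ := hB w hw
    exact ⟨hst _ h1, by rw [hfin _ h1, h2], hD.nodup _ h1⟩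
  · rw [hsum, ← hD.sum_edges]; rfl
  · rw [← hcount]
    have h1 : endsOf F.val = ((F.image fin).image fun w => st (q w)).val + (F.image fin).val := by
      have h2 : endsOf F.val = ∑ l ∈ F, listEnds l := rfl
      rw [h2, ← hsum, ← Finset.sum_multiset_singleton ((F.image fin).image fun w => st (q w)),
        Finset.sum_image hsinj', ← Finset.sum_multiset_singleton (F.image fin),
        ← Finset.sum_add_distrib]
      refine Finset.sum_congr rfl fun w hw => ?_
      obtain ⟨h3, h4⟩ := hB w hw
      rw [listEnds, hst _ h3, hfin _ h3, h4]
      rfl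
    rw [h1, Multiset.count_add, Multiset.count_eq_of_nodup (Finset.nodup _),
      Multiset.count_eq_of_nodup (Finset.nodup _)]
    rfl

/-! ### Staircases through the layers -/

theorem listEdges_append_of_getLast?_of_head? {l₁ l₂ : List α} {x y : α}
    (h₁ : l₁.getLast? = some x) (h₂ : l₂.head? = some y) :
    listEdges (l₁ ++ l₂) = listEdges l₁ + {s(x, y)} + listEdges l₂ := by
  obtain ⟨l, rfl⟩ := List.getLast?_eq_some_iff.1 h₁
  obtain ⟨k, rfl⟩ := List.head?_eq_some_iff.1 h₂
  rw [List.append_assoc, List.singleton_append, listEdges_append, add_right_comm,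
    add_comm _ {s(x, y)}, Multiset.singleton_add]

/-- The edges of the Cartesian product of the path with vertices `0, …, k` and the graph with
edge set `E`. -/
def layerEdges [Fintype α] (E : Multiset (Sym2 α)) : ℕ → Multiset (Sym2 (ℕ × α))
  | 0 => E.map (Sym2.map (Prod.mk 0))
  | k + 1 => layerEdges E k + ∑ v, {s((k, v), (k + 1, v))} + E.map (Sym2.map (Prod.mk (k + 1)))

theorem mk_mem_map_prodMk {E : Multiset (Sym2 α)} {k i j : ℕ} {u v : α} :
    s((i, u), (j, v)) ∈ E.map (Sym2.map (Prod.mk k)) ↔ i = k ∧ j = k ∧ s(u, v) ∈ E := by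
  rw [Multiset.mem_map]
  constructor
  · rintro ⟨e, he, h⟩
    induction e with
    | _ a b =>
      rw [Sym2.map_mk, Sym2.eq_iff] at h
      simp only [Prod.mk.injEq] at h
      rcases h with ⟨⟨rfl, rfl⟩, rfl, rfl⟩ | ⟨⟨rfl, rfl⟩, rfl, rfl⟩
      · exact ⟨rfl, rfl, he⟩
      · exact ⟨rfl, rfl, by rwa [Sym2.eq_swap]⟩
  · rintro ⟨rfl, rfl, h⟩
    exact ⟨_, h, rfl⟩

theorem mem_sum_vertical [Fintype α] {k : ℕ} {e : Sym2 (ℕ × α)} :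
    e ∈ (∑ v : α, ({s((k, v), (k + 1, v))} : Multiset (Sym2 (ℕ × α)))) ↔
      ∃ v, e = s((k, v), (k + 1, v)) := by
  rw [Multiset.mem_sum]; simp

theorem mk_mem_layerEdges [Fintype α] {E : Multiset (Sym2 α)} {k i j : ℕ} {u v : α} :
    s((i, u), (j, v)) ∈ layerEdges E k ↔
      i ≤ k ∧ j ≤ k ∧ (i = j ∧ s(u, v) ∈ E ∨ u = v ∧ (i + 1 = j ∨ j + 1 = i)) := by
  induction k with
  | zero =>
    rw [layerEdges, mk_mem_map_prodMk]
    constructor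
    · rintro ⟨rfl, rfl, h⟩; simp [h]
    · rintro ⟨h1, h2, ⟨h3, h4⟩ | h3⟩
      · exact ⟨by omega, by omega, h4⟩
      · omega
  | succ k ih =>
    rw [layerEdges, Multiset.mem_add, Multiset.mem_add, ih, mk_mem_map_prodMk, mem_sum_vertical]
    simp only [Sym2.eq_iff, Prod.mk.injEq]
    constructor
    · rintro ((⟨h1, h2, h3⟩ | ⟨w, ⟨⟨rfl, rfl⟩, rfl, rfl⟩ | ⟨⟨rfl, rfl⟩, rfl, rfl⟩⟩) | ⟨rfl, rfl, h⟩)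
      · exact ⟨by omega, by omega, h3⟩
      · simp
      · simp
      · simp [h]
    · rintro ⟨h1, h2, ⟨rfl, h⟩ | ⟨rfl, h⟩⟩
      · by_cases hi : i = k + 1
        · exact .inr ⟨hi, hi, h⟩
        · exact .inl (.inl ⟨by omega, by omega, .inl ⟨rfl, h⟩⟩)
      · by_cases hi : i = k + 1
        · exact .inl (.inr ⟨u, .inr ⟨⟨hi, rfl⟩, by omega, rfl⟩⟩)
        by_cases hj : j = k + 1
        · exact .inl (.inr ⟨u, .inl ⟨⟨by omega, rfl⟩, hj, rfl⟩⟩)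
        · exact .inl (.inl ⟨by omega, by omega, .inr ⟨rfl, h⟩⟩)

theorem nodup_layerEdges [Fintype α] {E : Multiset (Sym2 α)} (hE : E.Nodup) (k : ℕ) :
    (layerEdges E k).Nodup := by
  have hmap : ∀ j : ℕ, (E.map (Sym2.map (Prod.mk j))).Nodup := fun j =>
    hE.map (Sym2.map.injective (Prod.mk_right_injective j))
  induction k with
  | zero => exact hmap 0
  | succ k ih =>
    rw [layerEdges, Multiset.nodup_add, Multiset.nodup_add]
    refine ⟨⟨ih, ?_, ?_⟩, hmap _, ?_⟩
    · have : (∑ v : α, ({s((k, v), (k + 1, v))} : Multiset (Sym2 (ℕ × α)))) =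
          (Finset.univ : Finset α).val.map fun v => s((k, v), (k + 1, v)) := by
        rw [← Multiset.sum_map_singleton (Multiset.map _ _), Multiset.map_map]
        rfl
      rw [this]
      refine (Finset.nodup _).map fun v w h => ?_
      simpa using h
    · rw [Multiset.disjoint_left]
      intro e he h
      obtain ⟨v, rfl⟩ := mem_sum_vertical.1 h
      rw [mk_mem_layerEdges] at he
      omega
    · rw [Multiset.disjoint_left]
      intro e he h
      induction e with
      | _ x y =>
        obtain ⟨i, u⟩ := x
        obtain ⟨j, v⟩ := y
        rw [mk_mem_map_prodMk] at h
        rw [Multiset.mem_add, mk_mem_layerEdges, mem_sum_vertical] at he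
        rcases he with he | ⟨w, he⟩
        · omega
        · simp only [Sym2.eq_iff, Prod.mk.injEq] at he
          omega

/-- Oriented paths in a graph `H`, such that every vertex is the start of one path or the terminus
of one path, are combined to paths of the Cartesian product of a path and `H`. The list `T w`
is the path which terminates at the copy of `w` in the last layer. -/
theorem exists_staircases [Fintype α] [DecidableEq α] {E : Multiset (Sym2 α)} {B : Finset α}
    {q : α → List α} {s : α → α}
    (hq : ∀ w ∈ B, (q w).head? = some (s w) ∧ (q w).getLast? = some w ∧ (q w).Nodup)
    (hs : Set.InjOn s B) (hE : ∑ w ∈ B, listEdges (q w) = E) (hB : B.image s ∪ B = Finset.univ)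
    (k : ℕ) :
    ∃ (R : Multiset (List (ℕ × α))) (T : α → List (ℕ × α)),
      (∀ l ∈ R, l ≠ [] ∧ l.Nodup ∧ ∀ p ∈ l, p.1 ≤ k) ∧
      (∀ w ∈ B, (T w).getLast? = some (k, w) ∧ (T w).Nodup ∧ ∀ p ∈ T w, p.1 ≤ k) ∧
      (R.map listEdges).sum + ∑ w ∈ B, listEdges (T w) = layerEdges E k ∧
      R.card = k * (B \ B.image s).card := by
  have hlift : ∀ j : ℕ, ∑ w ∈ B, listEdges ((q w).map (Prod.mk j)) =
      E.map (Sym2.map (Prod.mk j)) := by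
    intro j
    simp only [listEdges_map]
    rw [← hE]
    exact (map_sum (Multiset.mapAddMonoidHom (Sym2.map (Prod.mk j))) _ _).symm
  have hnd : ∀ (j : ℕ), ∀ w ∈ B, ((q w).map (Prod.mk j)).Nodup := fun j w hw =>
    (hq w hw).2.2.map (Prod.mk_right_injective j)
  induction k with
  | zero =>
    refine ⟨0, fun w => (q w).map (Prod.mk 0), by simp, fun w hw => ⟨?_, hnd 0 w hw, ?_⟩, ?_,
      by simp⟩
    · simp [(hq w hw).2.1]
    · simp
    · simp [layerEdges, hlift]
  | succ k ih =>
    obtain ⟨R, T, hR, hT, hsum, hcard⟩ := ih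
    set A := B.image s with hA
    -- What comes before the vertical edge at $u$: the staircase arriving at $u$, or just the vertex
    -- $(k,u)$ if none arrives.
    let pre : α → List (ℕ × α) := fun u => if u ∈ B then T u else [(k, u)]
    have hpre : ∀ u, (pre u).getLast? = some (k, u) ∧ (pre u).Nodup ∧ ∀ p ∈ pre u, p.1 ≤ k := by
      intro u
      by_cases hu : u ∈ B
      · simp only [pre, if_pos hu]; exact hT u hu
      · simp [pre, if_neg hu]
    -- Staircases ending at $v\in B\setminus A$ climb one vertical edge and are closed, since no
    -- path starts at $v$. The new layer meets the old ones in no vertex, so all lists stay free of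
    -- repetitions.
    refine ⟨R + (B \ A).val.map fun v => T v ++ [(k + 1, v)],
      fun w => pre (s w) ++ (q w).map (Prod.mk (k + 1)), ?_, ?_, ?_, ?_⟩
    · intro l hl
      rw [Multiset.mem_add, Multiset.mem_map] at hl
      rcases hl with hl | ⟨v, hv, rfl⟩
      · obtain ⟨h1, h2, h3⟩ := hR l hl
        exact ⟨h1, h2, fun p hp => (h3 p hp).trans (Nat.le_succ k)⟩
      · obtain ⟨-, h2, h3⟩ := hT v (Finset.mem_sdiff.1 hv).1
        refine ⟨by simp, List.nodup_append.2 ⟨h2, by simp, ?_⟩, ?_⟩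
        · intro p hp r hr
          rw [List.mem_singleton] at hr
          rintro rfl
          have := h3 p hp
          rw [hr] at this
          simp at this
        · intro p hp
          rw [List.mem_append, List.mem_singleton] at hp
          rcases hp with hp | rfl
          · exact (h3 p hp).trans (Nat.le_succ k)
          · exact le_rfl
    · intro w hw
      obtain ⟨-, h2, h3⟩ := hpre (s w)
      refine ⟨?_, List.nodup_append.2 ⟨h2, hnd _ w hw, ?_⟩, ?_⟩
      · simp [List.getLast?_append, (hq w hw).2.1]
      · intro p hp r hr
        obtain ⟨v, -, rfl⟩ := List.mem_map.1 hr
        rintro rfl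
        have := h3 _ hp
        simp at this
      · intro p hp
        rw [List.mem_append, List.mem_map] at hp
        rcases hp with hp | ⟨v, -, rfl⟩
        · exact (h3 p hp).trans (Nat.le_succ k)
        · exact le_rfl
    · have h1 : ∑ w ∈ B, listEdges (pre (s w) ++ (q w).map (Prod.mk (k + 1))) =
          ∑ u ∈ A ∩ B, listEdges (T u) + ∑ u ∈ A, {s((k, u), (k + 1, u))} +
            E.map (Sym2.map (Prod.mk (k + 1))) := by
        have : ∀ w ∈ B, listEdges (pre (s w) ++ (q w).map (Prod.mk (k + 1))) =
            listEdges (pre (s w)) + {s((k, s w), (k + 1, s w))} +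
              listEdges ((q w).map (Prod.mk (k + 1))) := fun w hw =>
          listEdges_append_of_getLast?_of_head? (hpre _).1 (by simp [(hq w hw).1])
        rw [Finset.sum_congr rfl this, Finset.sum_add_distrib, Finset.sum_add_distrib, hlift,
          ← Finset.sum_ite_mem, hA, Finset.sum_image hs, Finset.sum_image hs]
        congr 2
        refine Finset.sum_congr rfl fun w _ => ?_
        by_cases hu : s w ∈ B <;> simp [pre, hu]
      have h2 : (((B \ A).val.map fun v => T v ++ [(k + 1, v)]).map listEdges).sum =
          ∑ v ∈ B \ A, listEdges (T v) + ∑ v ∈ B \ A, {s((k, v), (k + 1, v))} := by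
        rw [Multiset.map_map, ← Finset.sum_add_distrib]
        refine Finset.sum_congr rfl fun v hv => ?_
        rw [Function.comp_apply, listEdges_append_of_getLast?_of_head?
          (hT v (Finset.mem_sdiff.1 hv).1).1 (List.head?_cons (a := (k + 1, v)) (l := []))]
        simp
      -- Every old staircase is either continued ($A\cap B$) or closed ($B\setminus A$); likewise
      -- each vertical edge is used once, over $A$ or over $B\setminus A$.
      have h3 : ∑ u ∈ A ∩ B, listEdges (T u) + ∑ v ∈ B \ A, listEdges (T v) =
          ∑ w ∈ B, listEdges (T w) := by
        rw [Finset.inter_comm]; exact Finset.sum_inter_add_sum_sdiff B A _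
      have h4 : ∑ u ∈ A, ({s((k, u), (k + 1, u))} : Multiset (Sym2 (ℕ × α))) +
          ∑ v ∈ B \ A, {s((k, v), (k + 1, v))} = ∑ v, {s((k, v), (k + 1, v))} := by
        rw [← hB, ← Finset.union_sdiff_self_eq_union, Finset.sum_union Finset.disjoint_sdiff]
      rw [layerEdges, Multiset.map_add, Multiset.sum_add, h1, h2, ← hsum, ← h3, ← h4]
      abel
    · rw [Multiset.card_add, hcard, Multiset.card_map, Finset.card_val, Nat.succ_mul]

/-! ### From path systems to path decompositions -/

theorem exists_isPath_of_listEdges {G : SimpleGraph α} (l : List α) (x : α)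
    (hnd : (x :: l).Nodup) (hG : ∀ e ∈ listEdges (x :: l), e ∈ G.edgeSet) :
    ∃ (v : α) (w : G.Walk x v), w.IsPath ∧ w.support = x :: l ∧
      (w.edges : Multiset (Sym2 α)) = listEdges (x :: l) := by
  induction l generalizing x with
  | nil => exact ⟨x, .nil, by simp, by simp, by simp⟩
  | cons y l ih =>
    obtain ⟨v, w, hw, hsupp, hedges⟩ := ih y (List.nodup_cons.1 hnd).2
      (fun e he => hG e (by rw [listEdges_cons_cons]; exact Multiset.mem_cons_of_mem he))
    have hadj : G.Adj x y := hG s(x, y) (by simp)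
    refine ⟨v, .cons hadj w, ?_, ?_, ?_⟩
    · rw [Walk.cons_isPath_iff, hsupp]
      exact ⟨hw, (List.nodup_cons.1 hnd).1⟩
    · rw [Walk.support_cons, hsupp]
    · rw [Walk.edges_cons, ← Multiset.cons_coe, hedges, listEdges_cons_cons]

/-- A path system for the edges of `G` bounds the path number of `G`. -/
theorem pathNumber_le_of_pathSystem {G : SimpleGraph α} {D : Multiset (List α)}
    {E : Multiset (Sym2 α)} (hD : PathSystem D E) (hE : E.Nodup)
    (hG : ∀ e, e ∈ E ↔ e ∈ G.edgeSet) : pathNumber G ≤ D.card := by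
  classical
  have hex : ∀ l ∈ D, ∃ P : G.Subgraph, IsPathSubgraph P ∧
      ∀ e, e ∈ P.edgeSet ↔ e ∈ listEdges l := by
    intro l hl
    obtain ⟨x, t, rfl⟩ := List.exists_cons_of_ne_nil (hD.ne_nil l hl)
    obtain ⟨v, w, hw, -, hedges⟩ := exists_isPath_of_listEdges t x (hD.nodup _ hl)
      (fun e he => (hG e).1 (by
        rw [← hD.sum_edges]
        exact Multiset.mem_of_le (Multiset.le_sum_of_mem (Multiset.mem_map_of_mem _ hl)) he))
    exact ⟨w.toSubgraph, ⟨x, v, w, hw, rfl⟩, fun e => by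
      rw [Walk.mem_edges_toSubgraph, ← hedges, Multiset.mem_coe]⟩
  choose! P hP hPE using hex
  -- Different trivial lists may yield the same subgraph, and repeated lists merge; this only lowers
  -- the count.
  refine (pathNumber_le_card (D := D.toFinset.image P) ⟨?_, ?_, ?_⟩).trans
    (Finset.card_image_le.trans (Multiset.toFinset_card_le D))
  · intro Q hQ
    obtain ⟨l, hl, rfl⟩ := Finset.mem_image.1 hQ
    exact hP l (Multiset.mem_toFinset.1 hl)
  · intro Q hQ Q' hQ' hne
    obtain ⟨l, hl, rfl⟩ := Finset.mem_image.1 hQ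
    obtain ⟨l', hl', rfl⟩ := Finset.mem_image.1 hQ'
    rw [Multiset.mem_toFinset] at hl hl'
    have hll' : l' ≠ l := fun h => hne (by rw [h])
    rw [Set.disjoint_left]
    intro e he he'
    rw [hPE l hl] at he
    rw [hPE l' hl'] at he'
    obtain ⟨D₁, rfl⟩ := Multiset.exists_cons_of_mem hl
    obtain ⟨D₂, rfl⟩ := Multiset.exists_cons_of_mem ((Multiset.mem_cons.1 hl').resolve_left hll')
    rw [← hD.sum_edges] at hE
    simp only [Multiset.map_cons, Multiset.sum_cons] at hE
    exact Multiset.disjoint_left.1 (Multiset.nodup_add.1 hE).2.2 he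
      (Multiset.mem_add.2 (.inl he'))
  · intro e he
    rw [← hG, ← hD.sum_edges] at he
    obtain ⟨l, hl, hel⟩ : ∃ l ∈ D, e ∈ listEdges l := by
      have h : e ∈ D.bind listEdges := he
      simpa using h
    exact ⟨P l, Finset.mem_image_of_mem P (Multiset.mem_toFinset.2 hl), (hPE l hl e).2 hel⟩

/-- A path system for the layers `0, …, k` bounds the path number of the Cartesian product. -/
theorem pathNumber_boxProd_pathGraph_le [Fintype α] {H : SimpleGraph α} {k : ℕ}
    {D : Multiset (List (ℕ × α))} {E : Finset (Sym2 α)} (hE : ∀ e, e ∈ E ↔ e ∈ H.edgeSet)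
    (hD : PathSystem D (layerEdges E.val k)) (hk : ∀ l ∈ D, ∀ p ∈ l, p.1 ≤ k) :
    pathNumber (pathGraph (k + 1) □ H) ≤ D.card := by
  -- Natural-number layers stay fixed as $k$ grows, which suits the induction. Reduction modulo
  -- $k+1$ is faithful on the layers $0,\dots,k$ that occur.
  let f : ℕ × α → Fin (k + 1) × α := fun p => (Fin.ofNat (k + 1) p.1, p.2)
  have hfval : ∀ p : ℕ × α, p.1 ≤ k → (f p).1.val = p.1 := fun p hp =>
    Nat.mod_eq_of_lt (Nat.lt_succ_of_le hp)
  have hfinj : ∀ p r : ℕ × α, p.1 ≤ k → r.1 ≤ k → f p = f r → p = r := by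
    intro p r hp hr h
    refine Prod.ext ?_ (congrArg (fun x : Fin (k + 1) × α => x.2) h)
    rw [← hfval p hp, ← hfval r hr, h]
  have hadj : ∀ p r : ℕ × α, p.1 ≤ k → r.1 ≤ k →
      (s(p, r) ∈ layerEdges E.val k ↔ (pathGraph (k + 1) □ H).Adj (f p) (f r)) := by
    rintro ⟨i, u⟩ ⟨j, v⟩ hp hr
    simp only at hp hr
    rw [mk_mem_layerEdges, boxProd_adj, pathGraph_adj, hfval _ hp, hfval _ hr, Fin.ext_iff,
      hfval _ hp, hfval _ hr, Finset.mem_val, hE, mem_edgeSet]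
    simp only [f]
    tauto
  have hsys : PathSystem (D.map (List.map f)) ((layerEdges E.val k).map (Sym2.map f)) := by
    refine ⟨?_, ?_, ?_⟩
    · intro l hl
      obtain ⟨l', hl', rfl⟩ := Multiset.mem_map.1 hl
      simpa using hD.ne_nil l' hl'
    · intro l hl
      obtain ⟨l', hl', rfl⟩ := Multiset.mem_map.1 hl
      exact (hD.nodup l' hl').map_on fun p hp r hr h =>
        hfinj p r (hk l' hl' p hp) (hk l' hl' r hr) h
    · rw [← hD.sum_edges, Multiset.map_map]
      refine Eq.trans ?_ (map_multiset_sum (Multiset.mapAddMonoidHom (Sym2.map f)) _).symm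
      rw [Multiset.map_map]
      congr 1
      exact Multiset.map_congr rfl fun l _ => listEdges_map f l
  rw [← Multiset.card_map (List.map f) D]
  refine pathNumber_le_of_pathSystem hsys ?_ fun e => ?_
  · refine (nodup_layerEdges E.nodup k).map_on fun e he e' he' h => ?_
    induction e with
    | _ p r =>
      induction e' with
      | _ p' r' =>
        obtain ⟨h1, h2, -⟩ := mk_mem_layerEdges.1 he
        obtain ⟨h3, h4, -⟩ := mk_mem_layerEdges.1 he'
        rw [Sym2.map_mk, Sym2.map_mk, Sym2.eq_iff] at h
        rw [Sym2.eq_iff]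
        rcases h with ⟨h, h'⟩ | ⟨h, h'⟩
        · exact .inl ⟨hfinj _ _ h1 h3 h, hfinj _ _ h2 h4 h'⟩
        · exact .inr ⟨hfinj _ _ h1 h4 h, hfinj _ _ h2 h3 h'⟩
  · rw [Multiset.mem_map]
    constructor
    · rintro ⟨e', he', rfl⟩
      induction e' with
      | _ p r =>
        obtain ⟨h1, h2, -⟩ := mk_mem_layerEdges.1 he'
        exact (hadj p r h1 h2).1 he'
    · intro he
      induction e with
      | _ x y =>
        have hf : ∀ x : Fin (k + 1) × α, f (x.1.val, x.2) = x := fun x =>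
          Prod.ext (Fin.ext (hfval _ (Nat.le_of_lt_succ x.1.2))) rfl
        refine ⟨s((x.1.val, x.2), (y.1.val, y.2)), ?_, by rw [Sym2.map_mk, hf, hf]⟩
        rw [hadj _ _ (Nat.le_of_lt_succ x.1.2) (Nat.le_of_lt_succ y.1.2), hf, hf]
        exact he

/-! ### Counting the paths -/

theorem even_degree_iff_endDemand [Fintype α] [DecidableEq α] (H : SimpleGraph α)
    [DecidableRel H.Adj] (v : α) : Even (H.degree v) ↔ endDemand H.edgeFinset v = 2 := by
  rw [← card_incidenceFinset_eq_degree, incidenceFinset_eq_filter, endDemand]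
  split_ifs with h <;> simp [h]

/-- The staircases number $k|B\setminus A|+|B|$, where $|B|=|B\setminus A|+n_e$. From $|A|=|B|$ it
follows that the odd vertices, those in exactly one of $A$ and $B$, number $2|B\setminus A|$. -/
theorem two_mul_pathNumber_boxProd_pathGraph_le [Fintype α] [Nonempty α] (H : SimpleGraph α)
    [DecidableRel H.Adj] (k : ℕ) :
    2 * pathNumber (pathGraph (k + 1) □ H) ≤ (k + 1) * numOdd H + 2 * numEven H := by
  classical
  obtain ⟨B, q, s, hq, hs, hE, hdem⟩ := exists_oriented_paths H.edgeFinset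
    (fun e he => H.not_isDiag_of_mem_edgeFinset he)
  set A := B.image s with hA
  have hAB : A.card = B.card := Finset.card_image_of_injOn hs
  have hunion : A ∪ B = Finset.univ := by
    ext v
    have h := hdem v
    have := endDemand_pos H.edgeFinset v
    simp only [Finset.mem_union, Finset.mem_univ, iff_true]
    by_contra! hv
    rw [if_neg hv.1, if_neg hv.2] at h
    omega
  have heven : numEven H = (B ∩ A).card := by
    rw [numEven]
    congr 1
    ext v
    rw [Finset.mem_filter, even_degree_iff_endDemand, ← hdem v, Finset.mem_inter]
    by_cases h1 : v ∈ A <;> by_cases h2 : v ∈ B <;> simp [h1, h2]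
  have htotal : numOdd H + numEven H = (A ∪ B).card := by
    rw [hunion, numOdd, numEven, Finset.card_univ, ← Finset.card_univ, add_comm,
      ← Finset.card_filter_add_card_filter_not (s := Finset.univ) (fun v => Even (H.degree v))]
    simp only [Nat.not_even_iff_odd]
  have hdiff := Finset.card_inter_add_card_sdiff B A
  have hcu := Finset.card_union_add_card_inter A B
  rw [Finset.inter_comm] at hcu
  obtain ⟨R, T, hR, hT, hsum, hcard⟩ := exists_staircases hq hs hE hunion k
  have hle : pathNumber (pathGraph (k + 1) □ H) ≤ (R + B.val.map T).card := by
    refine pathNumber_boxProd_pathGraph_le (E := H.edgeFinset) (fun e => mem_edgeFinset)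
      ⟨?_, ?_, ?_⟩ ?_
    · intro l hl
      rw [Multiset.mem_add, Multiset.mem_map] at hl
      rcases hl with hl | ⟨w, hw, rfl⟩
      · exact (hR l hl).1
      · intro h
        have := (hT w hw).1
        simp [h] at this
    · intro l hl
      rw [Multiset.mem_add, Multiset.mem_map] at hl
      rcases hl with hl | ⟨w, hw, rfl⟩
      · exact (hR l hl).2.1
      · exact (hT w hw).2.1
    · rw [Multiset.map_add, Multiset.sum_add, Multiset.map_map, ← hsum]
      rfl
    · intro l hl
      rw [Multiset.mem_add, Multiset.mem_map] at hl
      rcases hl with hl | ⟨w, hw, rfl⟩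
      · exact (hR l hl).2.2
      · exact (hT w hw).2.2
  rw [Multiset.card_add, hcard, Multiset.card_map, Finset.card_val] at hle
  have hodd : numOdd H = 2 * (B \ A).card := by omega
  rw [hodd]
  nlinarith

end GallaiPath

theorem theorem3p1 {V : Type*} [Fintype V] (H : SimpleGraph V) [DecidableRel H.Adj]
    (hH : H.Connected) (m : ℕ) (hm : 2 ≤ m) :
    (GallaiPath.pathNumber (SimpleGraph.boxProd (SimpleGraph.pathGraph m) H) : ℚ) ≤
        (m : ℚ) * (GallaiPath.numOdd H : ℚ) / 2 + (GallaiPath.numEven H : ℚ) ∧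
      (GallaiPath.pathNumber (SimpleGraph.boxProd (SimpleGraph.pathGraph m) H) : ℚ) ≤
        (Fintype.card (Fin m × V) : ℚ) / 2 := by
  have := hH.nonempty
  obtain ⟨k, rfl⟩ : ∃ k, m = k + 1 := ⟨m - 1, by omega⟩
  have hmain := GallaiPath.two_mul_pathNumber_boxProd_pathGraph_le H k
  have hcard : Fintype.card V = GallaiPath.numOdd H + GallaiPath.numEven H := by
    rw [GallaiPath.numOdd, GallaiPath.numEven, ← Finset.card_univ, add_comm,
      ← Finset.card_filter_add_card_filter_not (s := Finset.univ) (fun v => Even (H.degree v))]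
    simp only [Nat.not_even_iff_odd]
  have hbound : 2 * GallaiPath.pathNumber (SimpleGraph.boxProd (SimpleGraph.pathGraph (k + 1)) H) ≤
      Fintype.card (Fin (k + 1) × V) := by
    rw [Fintype.card_prod, Fintype.card_fin, hcard, mul_add]
    -- Two layers suffice to bound $2n_e$ by $m\,n_e$.
    exact hmain.trans (Nat.add_le_add_left (Nat.mul_le_mul_right _ hm) _)
  have h1 : (2 * GallaiPath.pathNumber (SimpleGraph.boxProd (SimpleGraph.pathGraph (k + 1)) H) : ℚ) ≤
      ((k + 1 : ℕ) : ℚ) * GallaiPath.numOdd H + 2 * GallaiPath.numEven H := by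
    exact_mod_cast hmain
  have h2 : (2 * GallaiPath.pathNumber (SimpleGraph.boxProd (SimpleGraph.pathGraph (k + 1)) H) : ℚ) ≤
      (Fintype.card (Fin (k + 1) × V) : ℚ) := by
    exact_mod_cast hbound
  constructor <;> linarith
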